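/- A \emph{skew shape} $\sigma/\rho$ is the set-theoretic difference of the Young diagrams of two partitions with $\rho\subseteq\sigma$; two skew shapes are identified if one is a translate of the other. It is \emph{connected} if any two of its squares are joined by a sequence of squares of the shape in which consecutive squares share an edge. For a nonempty connected skew shape $\alpha$ let $\operatorname{row}(\alpha)$, $\operatorname{col}(\alpha)$ and $\operatorname{area}(\alpha)$ be its numbers of nonempty rows, nonempty columns and squares. A \emph{diagonal} of $\alpha$ is the set of its squares in row $i$ and column $j$ with $i-j=k$, for a fixed integer $k$. Let $\mathrm{CS}^{\le n}$ be the set of nonempty connected skew shapes (up to translation) in which every diagonal has at most $n$ squares. The $q$-Lommel polynomials $R_{m,\nu}(z;q)$ are the Laurent polynomials in $z$ defined by $R_{-1,\nu}(z;q)=0$, $R_{0,\nu}(z;q)=1$ and $$R_{m+1,\nu}(z;q)=\bigl(z+z^{-1}(1-q^{\nu+m})\bigr)R_{m,\nu}(z;q)-R_{m-1,\nu}(z;q)\qquad(m\ge 0).$$ Regard $z$, $q$ and $q^\nu$ as independent variables, with $(q^{-1})^{\nu+k}=(q^{\nu})^{-1}q^{-k}$. \textbf{Theorem.} For every integer $m\ge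 0$, $$\sum_{\alpha\in \mathrm{CS}^{\le m+1}} (q^\nu z^2)^{\operatorname{col}(\alpha)} (q^\nu)^{\operatorname{row}(\alpha)} q^{\operatorname{area}(\alpha)} = -q^\nu z\,\frac{R_{m,\nu+2}(z;q^{-1})}{R_{m+1,\nu+1}(z;q^{-1})}.$$ Here the sum on the left converges in the ring of formal power series $\mathbb{Z}[[z,q,q^\nu]]$ (with coefficientwise convergence), $R_{m+1,\nu+1}(z;q^{-1})\neq 0$, and the identity holds in the field of fractions of that ring. -/

import Mathlib

open scoped MvPowerSeries.WithPiTopology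

/-- Two squares, given as `(row, column)`, share an edge. -/
def ShareEdge (u v : ℕ × ℕ) : Prop :=
  (u.1 = v.1 ∧ (u.2 + 1 = v.2 ∨ v.2 + 1 = u.2)) ∨
    (u.2 = v.2 ∧ (u.1 + 1 = v.1 ∨ v.1 + 1 = u.1))

/-- A placed nonempty connected skew shape: a nonempty set of squares of the form `σ / ρ` with
`ρ ⊆ σ` Young diagrams, in which any two squares are joined by a sequence of squares of the shape,
consecutive ones sharing an edge. -/
structure PlacedConnectedSkewShape where
  cells : Finset (ℕ × ℕ)
  isSkew : ∃ σ ρ : YoungDiagram, ρ ≤ σ ∧ cells = σ.cells \ ρ.cells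
  nonempty : cells.Nonempty
  connected : ∀ u ∈ cells, ∀ v ∈ cells,
    Relation.ReflTransGen (fun a b => a ∈ cells ∧ b ∈ cells ∧ ShareEdge a b) u v

namespace PlacedConnectedSkewShape

/-- `β` is obtained from `α` by translation by an integer vector `(a, b)`. -/
def IsTranslate (α β : PlacedConnectedSkewShape) : Prop :=
  ∃ a b : ℤ, β.cells.image (fun c : ℕ × ℕ => ((c.1 : ℤ), (c.2 : ℤ))) =
    α.cells.image (fun c : ℕ × ℕ => ((c.1 : ℤ) + a, (c.2 : ℤ) + b))

/-- The number of nonempty rows. -/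
def row (α : PlacedConnectedSkewShape) : ℕ := (α.cells.image Prod.fst).card

/-- The number of nonempty columns. -/
def col (α : PlacedConnectedSkewShape) : ℕ := (α.cells.image Prod.snd).card

/-- The number of squares. -/
def area (α : PlacedConnectedSkewShape) : ℕ := α.cells.card

/-- The number of squares `(i, j)` on the diagonal `i - j = k`. -/
def diagLength (α : PlacedConnectedSkewShape) (k : ℤ) : ℕ :=
  (α.cells.filter (fun c : ℕ × ℕ => (c.1 : ℤ) - (c.2 : ℤ) = k)).card

/-- Every diagonal has at most `m` squares. -/
def DiagLE (m : ℕ) (α : PlacedConnectedSkewShape) : Prop := ∀ k : ℤ, α.diagLength k ≤ m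

theorem isTranslate_equivalence : Equivalence IsTranslate := by
  have key : ∀ (S T : Finset (ℕ × ℕ)) (a b : ℤ),
      T.image (fun c : ℕ × ℕ => ((c.1 : ℤ), (c.2 : ℤ))) =
        S.image (fun c : ℕ × ℕ => ((c.1 : ℤ) + a, (c.2 : ℤ) + b)) ↔
      ∀ x y : ℤ, (∃ c ∈ T, (c.1 : ℤ) = x ∧ (c.2 : ℤ) = y) ↔
        ∃ c ∈ S, (c.1 : ℤ) = x - a ∧ (c.2 : ℤ) = y - b := by
    intro S T a b
    simp only [Finset.ext_iff, Finset.mem_image, Prod.forall, Prod.mk.injEq,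
      eq_sub_iff_add_eq]
  refine ⟨fun α => ⟨0, 0, by simp⟩, ?_, ?_⟩
  · rintro α β ⟨a, b, h⟩
    rw [key] at h
    refine ⟨-a, -b, (key _ _ _ _).2 fun x y => ?_⟩
    have := h (x + a) (y + b)
    simp only [add_sub_cancel_right] at this
    simpa only [sub_neg_eq_add] using this.symm
  · rintro α β γ ⟨a, b, h⟩ ⟨a', b', h'⟩
    rw [key] at h h'
    refine ⟨a' + a, b' + b, (key _ _ _ _).2 fun x y => ?_⟩
    rw [h' x y, h (x - a') (y - b'), sub_sub, sub_sub]

/-- Skew shapes are identified when one is obtained from the other by translation. -/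
instance setoid : Setoid PlacedConnectedSkewShape := ⟨IsTranslate, isTranslate_equivalence⟩

theorem row_congr (α β : PlacedConnectedSkewShape) (h : IsTranslate α β) : α.row = β.row := by
  obtain ⟨a, b, h⟩ := h
  have e := congrArg (fun s : Finset (ℤ × ℤ) => (s.image Prod.fst).card) h
  simp only [Finset.image_image] at e
  have h1 : β.cells.image (Prod.fst ∘ fun c : ℕ × ℕ => ((c.1 : ℤ), (c.2 : ℤ))) =
      (β.cells.image Prod.fst).image (fun n : ℕ => (n : ℤ)) := by
    rw [Finset.image_image]; rfl
  have h2 : α.cells.image (Prod.fst ∘ fun c : ℕ × ℕ => ((c.1 : ℤ) + a, (c.2 : ℤ) + b)) =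
      (α.cells.image Prod.fst).image (fun n : ℕ => (n : ℤ) + a) := by
    rw [Finset.image_image]; rfl
  rw [h1, h2, Finset.card_image_of_injective _ Nat.cast_injective,
    Finset.card_image_of_injective _
      (fun x y hxy => Nat.cast_injective (add_right_cancel hxy))] at e
  exact e.symm

theorem col_congr (α β : PlacedConnectedSkewShape) (h : IsTranslate α β) : α.col = β.col := by
  obtain ⟨a, b, h⟩ := h
  have e := congrArg (fun s : Finset (ℤ × ℤ) => (s.image Prod.snd).card) h
  simp only [Finset.image_image] at e
  have h1 : β.cells.image (Prod.snd ∘ fun c : ℕ × ℕ => ((c.1 : ℤ), (c.2 : ℤ))) =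
      (β.cells.image Prod.snd).image (fun n : ℕ => (n : ℤ)) := by
    rw [Finset.image_image]; rfl
  have h2 : α.cells.image (Prod.snd ∘ fun c : ℕ × ℕ => ((c.1 : ℤ) + a, (c.2 : ℤ) + b)) =
      (α.cells.image Prod.snd).image (fun n : ℕ => (n : ℤ) + b) := by
    rw [Finset.image_image]; rfl
  rw [h1, h2, Finset.card_image_of_injective _ Nat.cast_injective,
    Finset.card_image_of_injective _
      (fun x y hxy => Nat.cast_injective (add_right_cancel hxy))] at e
  exact e.symm

theorem cast_injective :
    Function.Injective (fun c : ℕ × ℕ => ((c.1 : ℤ), (c.2 : ℤ))) := by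
  rintro ⟨x, y⟩ ⟨x', y'⟩ h
  simpa using h

theorem cast_add_injective (a b : ℤ) :
    Function.Injective (fun c : ℕ × ℕ => ((c.1 : ℤ) + a, (c.2 : ℤ) + b)) := by
  rintro ⟨x, y⟩ ⟨x', y'⟩ h
  simpa using h

theorem area_congr (α β : PlacedConnectedSkewShape) (h : IsTranslate α β) :
    α.area = β.area := by
  obtain ⟨a, b, h⟩ := h
  have e := congrArg Finset.card h
  rw [Finset.card_image_of_injective _ cast_injective,
    Finset.card_image_of_injective _ (cast_add_injective a b)] at e
  exact e.symm

theorem diagLE_of_isTranslate (m : ℕ) (α β : PlacedConnectedSkewShape) (h : IsTranslate α β)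
    (hα : α.DiagLE m) : β.DiagLE m := by
  obtain ⟨a, b, h⟩ := h
  intro k
  refine le_trans (le_of_eq ?_) (hα (k - a + b))
  have e := congrArg
    (fun s : Finset (ℤ × ℤ) => (s.filter (fun c : ℤ × ℤ => c.1 - c.2 = k)).card) h
  simp only [Finset.filter_image] at e
  rw [Finset.card_image_of_injective _ cast_injective,
    Finset.card_image_of_injective _ (cast_add_injective a b)] at e
  unfold diagLength
  rw [e]
  congr 1
  apply Finset.filter_congr
  intro c _
  constructor <;> intro hc <;> linarith

theorem diagLE_congr (m : ℕ) (α β : PlacedConnectedSkewShape) (h : IsTranslate α β) :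
    α.DiagLE m = β.DiagLE m :=
  propext ⟨diagLE_of_isTranslate m α β h,
    diagLE_of_isTranslate m β α (isTranslate_equivalence.symm h)⟩

end PlacedConnectedSkewShape

/-- The set of nonempty connected skew shapes, up to translation. -/
def ConnectedSkewShape : Type := Quotient PlacedConnectedSkewShape.setoid

namespace ConnectedSkewShape

/-- The number of nonempty rows. -/
def row : ConnectedSkewShape → ℕ :=
  Quotient.lift PlacedConnectedSkewShape.row PlacedConnectedSkewShape.row_congr

/-- The number of nonempty columns. -/
def col : ConnectedSkewShape → ℕ :=
  Quotient.lift PlacedConnectedSkewShape.col PlacedConnectedSkewShape.col_congr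

/-- The number of squares. -/
def area : ConnectedSkewShape → ℕ :=
  Quotient.lift PlacedConnectedSkewShape.area PlacedConnectedSkewShape.area_congr

/-- Every diagonal has at most `m` squares. -/
def DiagLE (m : ℕ) : ConnectedSkewShape → Prop :=
  Quotient.lift (PlacedConnectedSkewShape.DiagLE m) (PlacedConnectedSkewShape.diagLE_congr m)

end ConnectedSkewShape

/-- The connected skew shapes in which every diagonal has at most `m` squares. -/
abbrev BoundedSkewShape (m : ℕ) : Type := {α : ConnectedSkewShape // α.DiagLE m}

/-- The `q`-Lommel polynomial `R_{m,ν}(z;p)` with base `p`, where `t` stands for `p ^ ν`. The value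
at `m = 1` is the recurrence `R_{m+1} = (z + z⁻¹ (1 - p^{ν+m})) R_m - R_{m-1}` at `m = 0`
with `R_{-1} = 0`. -/
def qLommel {K : Type*} [Field K] (z p t : K) : ℕ → K
  | 0 => 1
  | 1 => z + z⁻¹ * (1 - t)
  | m + 2 => (z + z⁻¹ * (1 - t * p ^ (m + 1))) * qLommel z p t (m + 1) - qLommel z p t m

/-- Formal power series over `ℤ` in three independent variables `z`, `q` and `q ^ ν`. -/
abbrev PSeries : Type := MvPowerSeries (Fin 3) ℤ

instance PSeries.isDomain : IsDomain PSeries := NoZeroDivisors.to_isDomain _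

/-- The field of fractions of the ring of formal power series in `z`, `q`, `q ^ ν`. -/
abbrev PField : Type := FractionRing PSeries

/-- The variable `z`. -/
noncomputable def zVar : PSeries := MvPowerSeries.X 0

/-- The variable `q`. -/
noncomputable def qVar : PSeries := MvPowerSeries.X 1

/-- The variable `q ^ ν`. -/
noncomputable def qNu : PSeries := MvPowerSeries.X 2

/-- The term `(q^ν z²)^col (q^ν)^row q^area` of the generating function. -/
noncomputable def shapeWeight (α : ConnectedSkewShape) : PSeries :=
  (qNu * zVar ^ 2) ^ α.col * qNu ^ α.row * qVar ^ α.area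

/-- `R_{m,ν+k}(z;q⁻¹)`, with `(q⁻¹)^(ν+k) = (q^ν)⁻¹ q^(-k)`, as an element of the fraction field. -/
noncomputable def lommelR (m k : ℕ) : PField :=
  qLommel (algebraMap PSeries PField zVar) (algebraMap PSeries PField qVar)⁻¹
    ((algebraMap PSeries PField qNu)⁻¹ * (algebraMap PSeries PField qVar)⁻¹ ^ k) m

/-! A connected skew shape is cut into its diagonals, read from the lower left corner to the upper
right one. Passing to the next diagonal is one step, north or east, of each of the two boundary
paths, so the length of the diagonal changes by at most one. Up to translation the shape is thus a
word in pairs of steps, starting and ending at length 1 with all lengths in `[1, n]`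
(`shapeOfWord_bijective`). Columns are counted by the upper path, rows by the lower path, and the
area is the sum of the lengths.

Write `t` for `q^ν` and `F h` for the generating function of words that start at length `h`.
Removing the first step gives `F h = q^h ([h = 1] (tz)^2 + (t + tz^2) F h + F (h+1) + (tz)^2 F
(h-1))`, with `F 0 = F (n+1) = 0` (`wordSum_eq`, `wordSum_eq_zero`). Division by `q^h` turns this
into the Lommel recurrence in base `q⁻¹`, up to powers of `-tz`. Hence `F (k+2)` is an explicit
combination of `F 1` and two Lommel polynomials (`eq_qLommel_of_recurrence`). For `n = m + 1` the
condition `F (m+2) = 0` is linear in `F 1` and yields the quotient; a Casoratian identity shows that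
the denominator is nonzero. -/

/-! ### Diagonals and words of boundary steps -/

/-- The squares of the diagonal of length `h` whose upper left square is `(a, b)`. -/
def diagCells (a b : ℤ) (h : ℕ) : Finset (ℤ × ℤ) :=
  (Finset.range h).image fun e : ℕ => (a + e, b + e)

theorem mem_diagCells {a b : ℤ} {h : ℕ} {p : ℤ × ℤ} :
    p ∈ diagCells a b h ↔ p.2 - p.1 = b - a ∧ a ≤ p.1 ∧ p.1 < a + h := by
  obtain ⟨i, j⟩ := p
  simp only [diagCells, Finset.mem_image, Finset.mem_range, Prod.mk.injEq]
  constructor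
  · rintro ⟨e, he, rfl, rfl⟩
    omega
  · rintro ⟨h1, h2, h3⟩
    exact ⟨(i - a).toNat, by omega, by omega, by omega⟩

theorem card_diagCells (a b : ℤ) (h : ℕ) : (diagCells a b h).card = h := by
  rw [diagCells, Finset.card_image_of_injective, Finset.card_range]
  intro x y hxy
  simpa using hxy

/-- The two boundary paths of a connected skew shape, read from the lower left to the upper right,
are recorded by pairs of steps. The first entry tells whether the upper path goes east (and not
north), the second one tells the same for the lower path. This is the length of the diagonal that
follows a diagonal of length `h`. -/
def nextLen (h : ℕ) : Bool × Bool → ℕ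
  | (true, false) => h - 1
  | (false, true) => h + 1
  | _ => h

/-- The squares on and after the diagonal of length `h` with upper left square `(a, b)`, when the
boundary paths continue with the given steps. -/
def wordCells : List (Bool × Bool) → ℤ → ℤ → ℕ → Finset (ℤ × ℤ)
  | [], a, b, h => diagCells a b h
  | s :: w, a, b, h => diagCells a b h ∪
      wordCells w (if s.1 then a else a - 1) (if s.1 then b + 1 else b) (nextLen h s)

/-- All diagonals have length between `1` and `n`, and the last one has length `1`. -/
def IsWord (n : ℕ) : ℕ → List (Bool × Bool) → Prop
  | h, [] => h = 1 ∧ 1 ≤ n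
  | h, s :: w => 1 ≤ h ∧ h ≤ n ∧ IsWord n (nextLen h s) w

theorem IsWord.one_le {n h : ℕ} {w : List (Bool × Bool)} (hw : IsWord n h w) : 1 ≤ h := by
  cases w with
  | nil => exact hw.1.ge
  | cons s w => exact hw.1

theorem IsWord.le {n h : ℕ} {w : List (Bool × Bool)} (hw : IsWord n h w) : h ≤ n := by
  cases w with
  | nil => exact hw.1.trans_le hw.2
  | cons s w => exact hw.2.1

/-- The number of rows of the shape. -/
def wordRow : List (Bool × Bool) → ℕ
  | [] => 1
  | s :: w => (if s.2 then 0 else 1) + wordRow w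

/-- The number of columns of the shape. -/
def wordCol : List (Bool × Bool) → ℕ
  | [] => 1
  | s :: w => (if s.1 then 1 else 0) + wordCol w

/-- The number of squares of the shape. -/
def wordArea : ℕ → List (Bool × Bool) → ℕ
  | h, [] => h
  | h, s :: w => h + wordArea (nextLen h s) w

/-! ### Statistics of the shape of a word -/

theorem diagCells_subset_wordCells (w : List (Bool × Bool)) (a b : ℤ) (h : ℕ) :
    diagCells a b h ⊆ wordCells w a b h := by
  cases w with
  | nil => exact subset_rfl
  | cons s w => exact Finset.subset_union_left

/-- Either step of the upper path raises the content (column minus row) of the upper left square by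
exactly 1. Distinct diagonals therefore never overlap, and the first one can be peeled off. -/
theorem wordCells_content {w : List (Bool × Bool)} {a b : ℤ} {h : ℕ} {p : ℤ × ℤ}
    (hp : p ∈ wordCells w a b h) : b - a ≤ p.2 - p.1 := by
  induction w generalizing a b h with
  | nil => exact (mem_diagCells.1 hp).1.ge
  | cons s w ih =>
    rcases Finset.mem_union.1 hp with hp | hp
    · exact (mem_diagCells.1 hp).1.ge
    · have := ih hp
      obtain ⟨s1, s2⟩ := s
      cases s1 <;> simp at this <;> omega

theorem wordCells_tail_content {w : List (Bool × Bool)} {s : Bool × Bool} {a b : ℤ} {h : ℕ}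
    {p : ℤ × ℤ}
    (hp : p ∈ wordCells w (if s.1 then a else a - 1) (if s.1 then b + 1 else b) h) :
    b - a < p.2 - p.1 := by
  have := wordCells_content hp
  obtain ⟨s1, s2⟩ := s
  cases s1 <;> simp at this <;> omega

theorem mem_wordCells_of_content {w : List (Bool × Bool)} {a b : ℤ} {h : ℕ} {p : ℤ × ℤ}
    (hp : p.2 - p.1 = b - a) : p ∈ wordCells w a b h ↔ p ∈ diagCells a b h := by
  refine ⟨fun hw => ?_, fun hd => diagCells_subset_wordCells w a b h hd⟩
  cases w with
  | nil => exact hw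
  | cons s w =>
    rcases Finset.mem_union.1 hw with hw | hw
    · exact hw
    · have := wordCells_tail_content hw
      omega

theorem mem_wordCells_tail {w : List (Bool × Bool)} {s : Bool × Bool} {a b : ℤ} {h : ℕ}
    {p : ℤ × ℤ} (hp : b - a < p.2 - p.1) :
    p ∈ wordCells (s :: w) a b h ↔
      p ∈ wordCells w (if s.1 then a else a - 1) (if s.1 then b + 1 else b) (nextLen h s) := by
  rw [wordCells, Finset.mem_union, or_iff_right]
  intro hd
  have := (mem_diagCells.1 hd).1
  omega

theorem disjoint_diagCells_tail (w : List (Bool × Bool)) (s : Bool × Bool) (a b : ℤ) (h k : ℕ) :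
    Disjoint (diagCells a b h)
      (wordCells w (if s.1 then a else a - 1) (if s.1 then b + 1 else b) k) := by
  rw [Finset.disjoint_left]
  intro p hp hp'
  have := (mem_diagCells.1 hp).1
  have := wordCells_tail_content hp'
  omega

theorem card_wordCells (w : List (Bool × Bool)) (a b : ℤ) (h : ℕ) :
    (wordCells w a b h).card = wordArea h w := by
  induction w generalizing a b h with
  | nil => exact card_diagCells a b h
  | cons s w ih =>
    rw [wordCells, Finset.card_union_of_disjoint (disjoint_diagCells_tail w s a b h _),
      card_diagCells, ih, wordArea]

/-- The length drops only when the lower path goes north, which adds a row. In `IsWord.image_fst`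
this shows that the rows of the first diagonal leave no gap below the counted interval. -/
theorem IsWord.le_row {n h : ℕ} {w : List (Bool × Bool)} (hw : IsWord n h w) : h ≤ wordRow w := by
  induction w generalizing h with
  | nil => exact hw.1.le
  | cons s w ih =>
    have := ih hw.2.2
    obtain ⟨s1, s2⟩ := s
    cases s1 <;> cases s2 <;> simp [nextLen, wordRow] at * <;> omega

theorem IsWord.le_col {n h : ℕ} {w : List (Bool × Bool)} (hw : IsWord n h w) : h ≤ wordCol w := by
  induction w generalizing h with
  | nil => exact hw.1.le
  | cons s w ih =>
    have := ih hw.2.2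
    obtain ⟨s1, s2⟩ := s
    cases s1 <;> cases s2 <;> simp [nextLen, wordCol] at * <;> omega

theorem image_fst_diagCells (a b : ℤ) (h : ℕ) :
    (diagCells a b h).image Prod.fst = Finset.Ico a (a + h) := by
  ext i
  simp only [Finset.mem_image, mem_diagCells, Finset.mem_Ico, Prod.exists]
  constructor
  · rintro ⟨x, y, h, rfl⟩
    exact h.2
  · intro hi
    exact ⟨i, b - a + i, ⟨by simp, hi⟩, rfl⟩

theorem image_snd_diagCells (a b : ℤ) (h : ℕ) :
    (diagCells a b h).image Prod.snd = Finset.Ico b (b + h) := by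
  ext i
  simp only [Finset.mem_image, mem_diagCells, Finset.mem_Ico, Prod.exists]
  constructor
  · rintro ⟨x, y, h, rfl⟩
    omega
  · intro hi
    exact ⟨i - b + a, i, ⟨by ring, by omega, by omega⟩, rfl⟩

/-- The lower right end of the diagonal sits in row `a + h - 1` and moves up one row exactly at the
north steps of the lower path. Columns are dual, with the upper path. -/
theorem IsWord.image_fst {n h : ℕ} {w : List (Bool × Bool)} (hw : IsWord n h w) (a b : ℤ) :
    (wordCells w a b h).image Prod.fst = Finset.Ico (a + h - wordRow w) (a + h) := by
  induction w generalizing a b h with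
  | nil =>
    rw [wordCells, image_fst_diagCells, hw.1]
    simp [wordRow]
  | cons s w ih =>
    have h1 := hw.2.2.one_le
    have h2 := hw.2.2.le_row
    have h3 := hw.1
    rw [wordCells, Finset.image_union, image_fst_diagCells, ih hw.2.2]
    obtain ⟨s1, s2⟩ := s
    ext i
    cases s1 <;> cases s2 <;> simp [nextLen, wordRow] at * <;> omega

theorem IsWord.image_snd {n h : ℕ} {w : List (Bool × Bool)} (hw : IsWord n h w) (a b : ℤ) :
    (wordCells w a b h).image Prod.snd = Finset.Ico b (b + wordCol w) := by
  induction w generalizing a b h with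
  | nil =>
    rw [wordCells, image_snd_diagCells, hw.1]
    simp [wordCol]
  | cons s w ih =>
    have h1 := hw.2.2.one_le
    have h2 := hw.2.2.le_col
    have h3 := hw.1
    rw [wordCells, Finset.image_union, image_snd_diagCells, ih hw.2.2]
    obtain ⟨s1, s2⟩ := s
    ext i
    cases s1 <;> cases s2 <;> simp [nextLen, wordCol] at * <;> omega

theorem IsWord.fst_mem {n h : ℕ} {w : List (Bool × Bool)} (hw : IsWord n h w) {a b : ℤ}
    {p : ℤ × ℤ} (hp : p ∈ wordCells w a b h) : a + h - wordRow w ≤ p.1 ∧ p.1 < a + h := by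
  rw [← Finset.mem_Ico, ← hw.image_fst a b]
  exact Finset.mem_image_of_mem _ hp

theorem IsWord.snd_mem {n h : ℕ} {w : List (Bool × Bool)} (hw : IsWord n h w) {a b : ℤ}
    {p : ℤ × ℤ} (hp : p ∈ wordCells w a b h) : b ≤ p.2 ∧ p.2 < b + wordCol w := by
  rw [← Finset.mem_Ico, ← hw.image_snd a b]
  exact Finset.mem_image_of_mem _ hp

theorem IsWord.card_filter_le {n h : ℕ} {w : List (Bool × Bool)} (hw : IsWord n h w) (a b k : ℤ) :
    ((wordCells w a b h).filter fun p => p.1 - p.2 = k).card ≤ n := by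
  induction w generalizing a b h with
  | nil =>
    refine (Finset.card_filter_le _ _).trans ?_
    rw [wordCells, card_diagCells]
    exact hw.le
  | cons s w ih =>
    by_cases hk : k = a - b
    · refine le_trans (Finset.card_le_card ?_) ((card_diagCells a b h).trans_le hw.le)
      intro p hp
      rw [Finset.mem_filter] at hp
      exact (mem_wordCells_of_content (by omega)).1 hp.1
    · refine le_trans (Finset.card_le_card ?_) (ih hw.2.2 (if s.1 then a else a - 1) (if s.1 then b + 1 else b))
      intro p hp
      rw [Finset.mem_filter] at hp ⊢
      have := wordCells_content hp.1
      exact ⟨(mem_wordCells_tail (by omega)).1 hp.1, hp.2⟩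

theorem wordCells_translate (w : List (Bool × Bool)) (a b c d : ℤ) (h : ℕ) :
    (wordCells w a b h).image (fun p => (p.1 + c, p.2 + d)) = wordCells w (a + c) (b + d) h := by
  have key (a b : ℤ) (h : ℕ) :
      (diagCells a b h).image (fun p => (p.1 + c, p.2 + d)) = diagCells (a + c) (b + d) h := by
    rw [diagCells, diagCells, Finset.image_image]
    refine Finset.image_congr fun e _ => ?_
    simp only [Function.comp, Prod.mk.injEq]
    constructor <;> ring
  induction w generalizing a b h with
  | nil => exact key a b h
  | cons s w ih =>
    rw [wordCells, wordCells, Finset.image_union, key, ih]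
    congr 2 <;> split_ifs <;> ring

theorem IsWord.upper_left_mem {n h : ℕ} {w : List (Bool × Bool)} (hw : IsWord n h w) (a b : ℤ) :
    (a, b) ∈ wordCells w a b h :=
  diagCells_subset_wordCells w a b h (mem_diagCells.2 ⟨rfl, le_rfl, by have := hw.one_le; omega⟩)

theorem IsWord.lower_right_mem {n h : ℕ} {w : List (Bool × Bool)} (hw : IsWord n h w) (a b : ℤ) :
    (a + h - 1, b + h - 1) ∈ wordCells w a b h :=
  diagCells_subset_wordCells w a b h
    (mem_diagCells.2 ⟨by ring, by have := hw.one_le; simp only; omega, by simp⟩)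

/-! ### Convexity and connectedness of the shape of a word -/

/-- On the first diagonal, the global row and column bounds already place `y`. Beyond it, an `x` or
`z` on the first diagonal can be replaced by the upper left or lower right square of the next one.
The content hypothesis is needed because a tail starting with a long diagonal is not convex below
that diagonal. -/
theorem IsWord.mem_of_between {n h : ℕ} {w : List (Bool × Bool)} (hw : IsWord n h w) {a b : ℤ}
    {x y z : ℤ × ℤ} (hx : x ∈ wordCells w a b h) (hz : z ∈ wordCells w a b h)
    (hxy : x ≤ y) (hyz : y ≤ z) (hy : b - a ≤ y.2 - y.1) : y ∈ wordCells w a b h := by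
  rw [Prod.le_def] at hxy hyz
  induction w generalizing a b h x z with
  | nil =>
    have := mem_diagCells.1 hx
    have := mem_diagCells.1 hz
    have := hw.1
    exact mem_diagCells.2 ⟨by omega, by omega, by omega⟩
  | cons s w ih =>
    have hx1 := hw.snd_mem hx
    have hz1 := hw.fst_mem hz
    rcases hy.eq_or_lt with hy | hy
    · exact (mem_wordCells_of_content hy.symm).2 (mem_diagCells.2 ⟨by omega, by omega, by omega⟩)
    rw [mem_wordCells_tail hy]
    have hX : ∃ x' ∈ wordCells w (if s.1 then a else a - 1) (if s.1 then b + 1 else b)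
        (nextLen h s), x'.1 ≤ y.1 ∧ x'.2 ≤ y.2 := by
      rcases Finset.mem_union.1 hx with hx | hx
      · have := mem_diagCells.1 hx
        refine ⟨_, hw.2.2.upper_left_mem _ _, ?_⟩
        obtain ⟨s1, s2⟩ := s
        cases s1 <;> simp <;> omega
      · exact ⟨x, hx, hxy⟩
    have hZ : ∃ z' ∈ wordCells w (if s.1 then a else a - 1) (if s.1 then b + 1 else b)
        (nextLen h s), y.1 ≤ z'.1 ∧ y.2 ≤ z'.2 := by
      rcases Finset.mem_union.1 hz with hz | hz
      · have := mem_diagCells.1 hz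
        refine ⟨_, hw.2.2.lower_right_mem _ _, ?_⟩
        have := hw.2.2.one_le
        obtain ⟨s1, s2⟩ := s
        cases s1 <;> cases s2 <;> simp [nextLen] at * <;> omega
      · exact ⟨z, hz, hyz⟩
    obtain ⟨x', hx', hxy'⟩ := hX
    obtain ⟨z', hz', hyz'⟩ := hZ
    refine ih hw.2.2 hx' hz' hxy' hyz' ?_
    obtain ⟨s1, s2⟩ := s
    cases s1 <;> simp <;> omega

/-- Two squares of the plane share an edge. -/
def ShareEdgeInt (u v : ℤ × ℤ) : Prop :=
  (u.1 = v.1 ∧ (u.2 + 1 = v.2 ∨ v.2 + 1 = u.2)) ∨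
    (u.2 = v.2 ∧ (u.1 + 1 = v.1 ∨ v.1 + 1 = u.1))

/-- Two squares of `S` share an edge. -/
def AdjIn (S : Finset (ℤ × ℤ)) (u v : ℤ × ℤ) : Prop := u ∈ S ∧ v ∈ S ∧ ShareEdgeInt u v

theorem AdjIn.mono {S T : Finset (ℤ × ℤ)} (h : S ⊆ T) {u v : ℤ × ℤ} (huv : AdjIn S u v) :
    AdjIn T u v := ⟨h huv.1, h huv.2.1, huv.2.2⟩

theorem AdjIn.symm {S : Finset (ℤ × ℤ)} {u v : ℤ × ℤ} (huv : AdjIn S u v) : AdjIn S v u := by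
  refine ⟨huv.2.1, huv.1, ?_⟩
  have := huv.2.2
  unfold ShareEdgeInt at *
  omega

/-- Every square of a diagonal has a neighbour on the next diagonal, and the last diagonal is a
single square. -/
theorem IsWord.connected {n h : ℕ} {w : List (Bool × Bool)} (hw : IsWord n h w) {a b : ℤ}
    {u v : ℤ × ℤ} (hu : u ∈ wordCells w a b h) (hv : v ∈ wordCells w a b h) :
    Relation.ReflTransGen (AdjIn (wordCells w a b h)) u v := by
  induction w generalizing a b h u v with
  | nil =>
    have h1 := mem_diagCells.1 hu
    have h2 := mem_diagCells.1 hv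
    have := hw.1
    have : u = v := Prod.ext (by omega) (by omega)
    rw [this]
  | cons s w ih =>
    have key : ∀ u ∈ wordCells (s :: w) a b h, ∃ u' ∈ wordCells w (if s.1 then a else a - 1)
        (if s.1 then b + 1 else b) (nextLen h s),
        Relation.ReflTransGen (AdjIn (wordCells (s :: w) a b h)) u u' ∧
        Relation.ReflTransGen (AdjIn (wordCells (s :: w) a b h)) u' u := by
      intro u hu
      rcases Finset.mem_union.1 hu with hd | hd
      · suffices hs : ∃ u' ∈ diagCells (if s.1 then a else a - 1)
            (if s.1 then b + 1 else b) (nextLen h s), ShareEdgeInt u u' by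
          obtain ⟨u', hu', he⟩ := hs
          have hu'' := diagCells_subset_wordCells w _ _ _ hu'
          have hadj : AdjIn (wordCells (s :: w) a b h) u u' :=
            ⟨hu, Finset.mem_union_right _ hu'', he⟩
          exact ⟨u', hu'', .single hadj, .single hadj.symm⟩
        have h1 := mem_diagCells.1 hd
        have h2 := hw.2.2.one_le
        -- Move right if the upper path goes east, and up otherwise. The exception is the last
        -- square of a shrinking diagonal, which has only an upper neighbour.
        by_cases hs : (s.1 = true ∧ u.1 < a + nextLen h s)
        · refine ⟨(u.1, u.2 + 1), mem_diagCells.2 ?_, by simp [ShareEdgeInt]⟩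
          simp only [hs.1, if_true]
          exact ⟨by omega, by omega, hs.2⟩
        · refine ⟨(u.1 - 1, u.2), mem_diagCells.2 ?_, by simp [ShareEdgeInt]⟩
          obtain ⟨s1, s2⟩ := s
          cases s1 <;> cases s2 <;> simp [nextLen] at * <;> omega
      · exact ⟨u, hd, .refl, .refl⟩
    obtain ⟨u', hu', huu', -⟩ := key u hu
    obtain ⟨v', hv', -, hvv'⟩ := key v hv
    refine (huu'.trans ?_).trans hvv'
    exact Relation.ReflTransGen.mono (fun _ _ => AdjIn.mono Finset.subset_union_right) _ _
      (ih hw.2.2 hu' hv')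

/-! ### The shape determines the word -/

theorem diagCells_injective {a b a' b' : ℤ} {h h' : ℕ} (hh : 1 ≤ h) (hh' : 1 ≤ h')
    (e : diagCells a b h = diagCells a' b' h') : a = a' ∧ b = b' ∧ h = h' := by
  have h1 := mem_diagCells.1 (e ▸ mem_diagCells.2 ⟨rfl, le_rfl, by simp; omega⟩ :
    (a, b) ∈ diagCells a' b' h')
  have h2 := mem_diagCells.1 (e.symm ▸ mem_diagCells.2 ⟨rfl, le_rfl, by simp; omega⟩ :
    (a', b') ∈ diagCells a b h)
  have h3 := congrArg Finset.card e
  rw [card_diagCells, card_diagCells] at h3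
  simp only at h1 h2
  omega

/-- The first diagonal is intrinsic: it is the set of squares of least content. -/
theorem wordCells_head_injective {n : ℕ} {w w' : List (Bool × Bool)} {a b a' b' : ℤ} {h h' : ℕ}
    (hw : IsWord n h w) (hw' : IsWord n h' w') (e : wordCells w a b h = wordCells w' a' b' h') :
    a = a' ∧ b = b' ∧ h = h' := by
  have h1 := wordCells_content (e ▸ hw.upper_left_mem a b)
  have h2 := wordCells_content (e.symm ▸ hw'.upper_left_mem a' b')
  simp only at h1 h2
  have hc : b - a = b' - a' := by omega
  refine diagCells_injective hw.one_le hw'.one_le (Finset.ext fun p => ?_)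
  by_cases hp : p.2 - p.1 = b - a
  · rw [← mem_wordCells_of_content hp (w := w), e, mem_wordCells_of_content (hp.trans hc)]
  · exact iff_of_false (fun hm => hp (mem_diagCells.1 hm).1)
      (fun hm => hp ((mem_diagCells.1 hm).1.trans hc.symm))

theorem wordCells_cons_ne_nil {n : ℕ} {w : List (Bool × Bool)} {s : Bool × Bool} {a b : ℤ} {h : ℕ}
    (hw : IsWord n h (s :: w)) : wordCells (s :: w) a b h ≠ wordCells [] a b h := by
  intro e
  have h1 := hw.2.2.upper_left_mem (if s.1 then a else a - 1) (if s.1 then b + 1 else b)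
  have h2 := wordCells_tail_content h1
  have h3 : _ ∈ wordCells (s :: w) a b h := Finset.mem_union_right _ h1
  rw [e] at h3
  have h4 := (mem_diagCells.1 h3).1
  omega

theorem wordCells_injective {n : ℕ} {w w' : List (Bool × Bool)} {a b a' b' : ℤ} {h h' : ℕ}
    (hw : IsWord n h w) (hw' : IsWord n h' w') (e : wordCells w a b h = wordCells w' a' b' h') :
    w = w' := by
  induction w generalizing a b h a' b' h' w' with
  | nil =>
    obtain ⟨rfl, rfl, rfl⟩ := wordCells_head_injective hw hw' e
    cases w' with
    | nil => rfl
    | cons s w' => exact absurd e.symm (wordCells_cons_ne_nil hw')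
  | cons s w ih =>
    obtain ⟨rfl, rfl, rfl⟩ := wordCells_head_injective hw hw' e
    cases w' with
    | nil => exact absurd e (wordCells_cons_ne_nil hw)
    | cons s' w' =>
      have ht : wordCells w (if s.1 then a else a - 1) (if s.1 then b + 1 else b) (nextLen h s) =
          wordCells w' (if s'.1 then a else a - 1) (if s'.1 then b + 1 else b)
            (nextLen h s') := by
        ext p
        by_cases hp : b - a < p.2 - p.1
        · rw [← mem_wordCells_tail hp, e, mem_wordCells_tail hp]
        · exact iff_of_false (fun hm => hp (wordCells_tail_content hm))
            (fun hm => hp (wordCells_tail_content hm))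
      obtain ⟨h1, -, h3⟩ := wordCells_head_injective hw.2.2 hw'.2.2 ht
      -- The upper left square of the tail gives the upper step and its length gives the lower one;
      -- `1 ≤ h` keeps the truncated `h - 1` different from `h`.
      have h4 := hw.1
      rw [ih hw.2.2 hw'.2.2 ht, List.cons_eq_cons]
      refine ⟨?_, rfl⟩
      obtain ⟨s1, s2⟩ := s
      obtain ⟨s1', s2'⟩ := s'
      cases s1 <;> cases s2 <;> cases s1' <;> cases s2' <;> simp [nextLen] at * <;> omega

/-! ### Reading the word off a set of squares -/

/-- The hypotheses are a form of convexity and connectedness that survives removal of the first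
diagonal: convexity only from the current content on, and neighbours on the adjacent diagonals in
place of paths. -/
theorem exists_word (n : ℕ) (S : Finset (ℤ × ℤ)) (a b : ℤ) (h : ℕ) (hh : 1 ≤ h)
    (hcont : ∀ p ∈ S, b - a ≤ p.2 - p.1)
    (hdiag : ∀ p : ℤ × ℤ, p.2 - p.1 = b - a → (p ∈ S ↔ a ≤ p.1 ∧ p.1 < a + h))
    (hconv : ∀ x ∈ S, ∀ z ∈ S, ∀ y : ℤ × ℤ, x ≤ y → y ≤ z → b - a ≤ y.2 - y.1 → y ∈ S)
    (hnext : ∀ p ∈ S, (∃ r ∈ S, p.2 - p.1 < r.2 - r.1) →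
      (p.1 - 1, p.2) ∈ S ∨ (p.1, p.2 + 1) ∈ S)
    (hprev : ∀ p ∈ S, b - a < p.2 - p.1 → (p.1 + 1, p.2) ∈ S ∨ (p.1, p.2 - 1) ∈ S)
    (hbound : ∀ k : ℤ, (S.filter fun p => p.1 - p.2 = k).card ≤ n) :
    ∃ w, IsWord n h w ∧ wordCells w a b h = S := by
  induction S using Finset.strongInduction generalizing a b h with
  | H S ih =>
    have hsub : diagCells a b h ⊆ S := fun p hp =>
      (hdiag p (mem_diagCells.1 hp).1).2 (mem_diagCells.1 hp).2
    have hn : h ≤ n := by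
      rw [← card_diagCells a b h]
      refine (Finset.card_le_card fun p hp => ?_).trans (hbound (a - b))
      have := (mem_diagCells.1 hp).1
      exact Finset.mem_filter.2 ⟨hsub hp, by omega⟩
    by_cases hex : ∃ r ∈ S, b - a < r.2 - r.1
    · obtain ⟨r, hr, hrc⟩ := hex
      set T := S.filter fun p => b - a < p.2 - p.1 with hT
      have hmT : ∀ p, p ∈ T ↔ p ∈ S ∧ b - a < p.2 - p.1 := fun p => by rw [hT, Finset.mem_filter]
      -- The inner squares of the next diagonal lie between consecutive squares of the first and are
      -- forced by convexity. By `hprev` nothing lies outside its two possible end squares, so only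
      -- those two remain to be decided.
      have hd' : ∀ i j : ℤ, j - i = b - a + 1 → ((i, j) ∈ S ↔
          (a ≤ i ∧ i < a + h - 1) ∨ (i = a - 1 ∧ (a - 1, b) ∈ S) ∨
            (i = a + h - 1 ∧ (a + h - 1, b + h) ∈ S)) := by
        intro i j hij
        constructor
        · intro hp
          have h1 := hprev _ hp (by simp only; omega)
          rw [hdiag (_ + 1, _) (by simp only; omega), hdiag (_, _ - 1) (by simp only; omega)] at h1
          simp only at h1
          by_cases h2 : i = a - 1
          · have h3 : j = b := by omega
            exact .inr (.inl ⟨h2, h2 ▸ h3 ▸ hp⟩)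
          by_cases h4 : i = a + h - 1
          · have h5 : j = b + h := by omega
            exact .inr (.inr ⟨h4, h4 ▸ h5 ▸ hp⟩)
          · omega
        · rintro (⟨h1, h2⟩ | ⟨rfl, h2⟩ | ⟨rfl, h2⟩)
          · refine hconv (i, j - 1) ((hdiag _ (by simp only; omega)).2 ⟨h1, by simp only; omega⟩)
              (i + 1, j) ((hdiag _ (by simp only; omega)).2 ⟨by simp only; omega, by simp only; omega⟩)
              (i, j) ?_ ?_ (by simp only; omega)
            · simp [Prod.le_def]
            · simp [Prod.le_def]
          · obtain rfl : j = b := by omega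
            exact h2
          · obtain rfl : j = b + h := by omega
            exact h2
      have step : ∀ s : Bool × Bool, 1 ≤ nextLen h s →
          (∀ p : ℤ × ℤ, p.2 - p.1 = b - a + 1 → (p ∈ S ↔ (if s.1 then a else a - 1) ≤ p.1 ∧
            p.1 < (if s.1 then a else a - 1) + nextLen h s)) →
          ∃ w, IsWord n h w ∧ wordCells w a b h = S := by
        intro s hs1 hs2
        have hc : (if s.1 then b + 1 else b) - (if s.1 then a else a - 1) = b - a + 1 := by
          split_ifs <;> ring
        suffices hs : ∃ w, IsWord n (nextLen h s) w ∧
            wordCells w (if s.1 then a else a - 1) (if s.1 then b + 1 else b) (nextLen h s) = T by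
          obtain ⟨w, hw1, hw2⟩ := hs
          refine ⟨s :: w, ⟨hh, hn, hw1⟩, ?_⟩
          rw [wordCells, hw2]
          ext p
          rw [Finset.mem_union, mem_diagCells, hmT]
          constructor
          · rintro (hp | hp)
            · exact (hdiag p hp.1).2 hp.2
            · exact hp.1
          · intro hp
            rcases (hcont p hp).eq_or_lt with hpc | hpc
            · exact .inl ⟨hpc.symm, (hdiag p hpc.symm).1 hp⟩
            · exact .inr ⟨hp, hpc⟩
        refine ih T ?_ _ _ _ hs1 ?_ ?_ ?_ ?_ ?_ ?_
        · refine Finset.filter_ssubset.2 ⟨(a, b), ?_, lt_irrefl _⟩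
          exact (hdiag _ rfl).2 ⟨le_rfl, by simp only; omega⟩
        · intro p hp
          have := ((hmT p).1 hp).2
          omega
        · intro p hp
          rw [hc] at hp
          rw [hmT, hs2 p hp, and_iff_left]
          omega
        · intro x hx z hz y hxy hyz hy
          rw [hc] at hy
          rw [hmT] at hx hz ⊢
          exact ⟨hconv x hx.1 z hz.1 y hxy hyz (by omega), by omega⟩
        · rintro p hp ⟨r, hr, hpr⟩
          rw [hmT] at hp hr
          simp only [hmT]
          refine (hnext p hp.1 ⟨r, hr.1, hpr⟩).imp (fun h => ⟨h, ?_⟩) (fun h => ⟨h, ?_⟩) <;> omega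
        · intro p hp hpc
          rw [hc] at hpc
          rw [hmT] at hp
          simp only [hmT]
          refine (hprev p hp.1 hp.2).imp (fun h => ⟨h, ?_⟩) (fun h => ⟨h, ?_⟩) <;> omega
        · intro k
          exact (Finset.card_le_card
            (Finset.filter_subset_filter _ (Finset.filter_subset _ _))).trans (hbound k)
      -- The first end square is present exactly when the upper path goes north, the second exactly
      -- when the lower path goes east.
      by_cases hN : (a - 1, b) ∈ S <;> by_cases hE : (a + h - 1, b + h) ∈ S
      · refine step (false, true) (by simp [nextLen]) fun p hp => ?_
        rw [← Prod.mk.eta (p := p), hd' _ _ hp]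
        simp only [hN, hE, nextLen]
        simp
        omega
      · refine step (false, false) (by simpa [nextLen]) fun p hp => ?_
        rw [← Prod.mk.eta (p := p), hd' _ _ hp]
        simp only [hN, hE, nextLen]
        simp
        omega
      · refine step (true, true) (by simpa [nextLen]) fun p hp => ?_
        rw [← Prod.mk.eta (p := p), hd' _ _ hp]
        simp only [hN, hE, nextLen]
        simp
        omega
      -- With both ends absent and `h = 1`, the square `(a, b)` would have no neighbour on the next
      -- diagonal although `r` lies beyond it.
      · have h2 : 2 ≤ h := by
          by_contra h2
          obtain rfl : h = 1 := by omega
          have := hnext (a, b) ((hdiag _ rfl).2 (by simp)) ⟨r, hr, hrc⟩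
          simp at hN hE this
          tauto
        refine step (true, false) (by simp only [nextLen]; omega) fun p hp => ?_
        rw [← Prod.mk.eta (p := p), hd' _ _ hp]
        simp only [hN, hE, nextLen]
        simp
        omega
    · push Not at hex
      -- Two squares on the final diagonal would force `(a, b + 1)`, which lies beyond it.
      have h1 : h = 1 := by
        by_contra hne
        have := hex (a, b + 1) (hconv (a, b) ((hdiag _ rfl).2 ⟨le_rfl, by simp only; omega⟩)
          (a + 1, b + 1) ((hdiag _ (by ring)).2 ⟨by simp, by simp only; omega⟩) _ (by simp [Prod.le_def])
          (by simp [Prod.le_def]) (by simp only; omega))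
        simp only at this
        omega
      refine ⟨[], ⟨h1, by omega⟩, Finset.Subset.antisymm hsub fun p hp => ?_⟩
      have hpc : p.2 - p.1 = b - a := le_antisymm (hex p hp) (hcont p hp)
      exact mem_diagCells.2 ⟨hpc, (hdiag p hpc).1 hp⟩

/-! ### Connected skew shapes as words -/

/-- Take `σ` to be the lower closure of `T` and `ρ` the rest of it; convexity of `T` makes `ρ` a
lower set. -/
theorem exists_youngDiagram_sdiff {T : Finset (ℕ × ℕ)}
    (hT : ∀ x ∈ T, ∀ z ∈ T, ∀ y, x ≤ y → y ≤ z → y ∈ T) :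
    ∃ σ ρ : YoungDiagram, ρ ≤ σ ∧ T = σ.cells \ ρ.cells := by
  have hmem : ∀ y, y ∈ T.biUnion Finset.Iic ↔ ∃ t ∈ T, y ≤ t := by simp
  refine ⟨⟨T.biUnion Finset.Iic, ?_⟩, ⟨T.biUnion Finset.Iic \ T, ?_⟩, ?_, ?_⟩
  · intro y x hxy hy
    rw [Finset.mem_coe, hmem] at hy ⊢
    exact hy.imp fun t ht => ⟨ht.1, hxy.trans ht.2⟩
  · intro y x hxy hy
    rw [Finset.mem_coe, Finset.mem_sdiff, hmem] at hy ⊢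
    obtain ⟨⟨t, ht, hyt⟩, hyT⟩ := hy
    exact ⟨⟨t, ht, hxy.trans hyt⟩, fun hx => hyT (hT x hx t ht y hxy hyt)⟩
  · exact Finset.sdiff_subset
  · symm
    exact Finset.sdiff_sdiff_eq_self fun t ht => (hmem t).2 ⟨t, ht, le_rfl⟩

/-- The embedding of the squares into the integer plane. -/
def intSquare (c : ℕ × ℕ) : ℤ × ℤ := (c.1, c.2)

theorem intSquare_injective : Function.Injective intSquare :=
  PlacedConnectedSkewShape.cast_injective

theorem shareEdgeInt_intSquare {u v : ℕ × ℕ} :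
    ShareEdgeInt (intSquare u) (intSquare v) ↔ ShareEdge u v := by
  unfold ShareEdgeInt ShareEdge intSquare
  simp only
  omega

theorem intSquare_le {u v : ℕ × ℕ} : intSquare u ≤ intSquare v ↔ u ≤ v := by
  simp [intSquare, Prod.le_def]

/-- An edge changes the content by 1, so a path crosses every intermediate diagonal, and an edge
raising the content goes north or east. -/
theorem AdjIn.exists_step {S : Finset (ℤ × ℤ)} {x y : ℤ × ℤ}
    (h : Relation.ReflTransGen (AdjIn S) x y) {c : ℤ} (hx : x.2 - x.1 ≤ c)
    (hy : c < y.2 - y.1) :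
    ∃ u ∈ S, u.2 - u.1 = c ∧ ((u.1 - 1, u.2) ∈ S ∨ (u.1, u.2 + 1) ∈ S) := by
  induction h with
  | refl => omega
  | @tail u v _ huv ih =>
    by_cases hu : c < u.2 - u.1
    · exact ih hu
    · obtain ⟨hu1, hv1, he⟩ := huv
      unfold ShareEdgeInt at he
      refine ⟨u, hu1, by omega, ?_⟩
      by_cases h1 : u.1 = v.1
      · exact .inr ((Prod.ext h1.symm (by simp only; omega) : v = (u.1, u.2 + 1)) ▸ hv1)
      · exact .inl ((Prod.ext (by simp only; omega) (by simp only; omega) :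
          v = (u.1 - 1, u.2)) ▸ hv1)

/-- By convexity the diagonal of least content is a single square, since two would enclose a square
of smaller content. Connectedness gives a crossing at some square `u` of the required diagonal, and
convexity carries the neighbour over to `p`. -/
theorem exists_word_of_connected (n : ℕ) (S : Finset (ℤ × ℤ)) (hne : S.Nonempty)
    (hconv : ∀ x ∈ S, ∀ z ∈ S, ∀ y, x ≤ y → y ≤ z → y ∈ S)
    (hconn : ∀ x ∈ S, ∀ y ∈ S, Relation.ReflTransGen (AdjIn S) x y)
    (hbound : ∀ k : ℤ, (S.filter fun p => p.1 - p.2 = k).card ≤ n) :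
    ∃ a b w, IsWord n 1 w ∧ wordCells w a b 1 = S := by
  obtain ⟨⟨a, b⟩, hab, hmin⟩ := S.exists_min_image (fun p => p.2 - p.1) hne
  simp only at hmin
  refine ⟨a, b, exists_word n S a b 1 le_rfl hmin ?_ (fun x hx z hz y h1 h2 _ =>
    hconv x hx z hz y h1 h2) ?_ ?_ hbound⟩
  · intro p hp
    constructor
    · intro hpS
      have h1 : ¬ p.1 < a := fun hlt => by
        have := hmin _ (hconv p hpS (a, b) hab (p.1 + 1, p.2)
          (by simp [Prod.le_def]) (by simp only [Prod.le_def]; omega))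
        simp only at this
        omega
      have h2 : ¬ a < p.1 := fun hlt => by
        have := hmin _ (hconv (a, b) hab p hpS (a + 1, b)
          (by simp [Prod.le_def]) (by simp only [Prod.le_def]; omega))
        simp only at this
        omega
      omega
    · intro hpa
      obtain rfl : p = (a, b) := Prod.ext (by simp only; omega) (by simp only; omega)
      exact hab
  · rintro p hp ⟨r, hr, hpr⟩
    obtain ⟨u, hu, huc, hu'⟩ := AdjIn.exists_step (hconn p hp r hr) le_rfl hpr
    rcases lt_trichotomy u.1 p.1 with hlt | heq | hlt
    · left
      rcases hu' with hu' | hu' <;>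
      exact hconv _ hu' _ hp _ (by simp only [Prod.le_def]; omega)
        (by simp only [Prod.le_def]; omega)
    · obtain rfl : u = p := Prod.ext heq (by omega)
      exact hu'
    · right
      rcases hu' with hu' | hu' <;>
      exact hconv _ hp _ hu' _ (by simp only [Prod.le_def]; omega)
        (by simp only [Prod.le_def]; omega)
  · intro p hp hpc
    obtain ⟨u, hu, huc, hu'⟩ := AdjIn.exists_step (hconn (a, b) hab p hp)
      (c := p.2 - p.1 - 1) (by simp only; omega) (by omega)
    by_cases hle : p.1 ≤ u.1 - 1
    · left
      exact hconv _ hp _ hu _ (by simp only [Prod.le_def]; omega)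
        (by simp only [Prod.le_def]; omega)
    · by_cases heq : u.1 = p.1
      · right
        exact (Prod.ext heq (by simp only; omega) : u = (p.1, p.2 - 1)) ▸ hu
      · right
        exact hconv _ hu _ hp _ (by simp only [Prod.le_def]; omega)
          (by simp only [Prod.le_def]; omega)

namespace PlacedConnectedSkewShape

/-- The squares of a placed shape as a subset of the integer plane. -/
def intCells (α : PlacedConnectedSkewShape) : Finset (ℤ × ℤ) := α.cells.image intSquare

theorem isTranslate_iff {α β : PlacedConnectedSkewShape} :
    IsTranslate α β ↔
      ∃ a b : ℤ, β.intCells = α.intCells.image fun p => (p.1 + a, p.2 + b) := by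
  simp only [intCells, Finset.image_image]
  rfl

theorem row_eq (α : PlacedConnectedSkewShape) : α.row = (α.intCells.image Prod.fst).card := by
  rw [intCells, Finset.image_image, row,
    ← Finset.card_image_of_injective _ (Nat.cast_injective (R := ℤ)), Finset.image_image]
  rfl

theorem col_eq (α : PlacedConnectedSkewShape) : α.col = (α.intCells.image Prod.snd).card := by
  rw [intCells, Finset.image_image, col,
    ← Finset.card_image_of_injective _ (Nat.cast_injective (R := ℤ)), Finset.image_image]
  rfl

theorem area_eq (α : PlacedConnectedSkewShape) : α.area = α.intCells.card :=
  (Finset.card_image_of_injective _ intSquare_injective).symm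

theorem diagLength_eq (α : PlacedConnectedSkewShape) (k : ℤ) :
    α.diagLength k = (α.intCells.filter fun p => p.1 - p.2 = k).card := by
  rw [intCells, Finset.filter_image, Finset.card_image_of_injective _ intSquare_injective]
  rfl

theorem mem_of_between (α : PlacedConnectedSkewShape) {x y z : ℕ × ℕ} (hx : x ∈ α.cells)
    (hz : z ∈ α.cells) (hxy : x ≤ y) (hyz : y ≤ z) : y ∈ α.cells := by
  obtain ⟨σ, ρ, -, h⟩ := α.isSkew
  rw [h, Finset.mem_sdiff] at hx hz ⊢
  exact ⟨σ.isLowerSet hyz hz.1, fun hy => hx.2 (ρ.isLowerSet hxy hy)⟩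

theorem intCells_mem_of_between (α : PlacedConnectedSkewShape) :
    ∀ x ∈ α.intCells, ∀ z ∈ α.intCells, ∀ y, x ≤ y → y ≤ z → y ∈ α.intCells := by
  intro x hx z hz y hxy hyz
  obtain ⟨x, hx', rfl⟩ := Finset.mem_image.1 hx
  obtain ⟨z, hz', rfl⟩ := Finset.mem_image.1 hz
  have h1 : (0 : ℤ) ≤ y.1 := (Int.natCast_nonneg x.1).trans hxy.1
  have h2 : (0 : ℤ) ≤ y.2 := (Int.natCast_nonneg x.2).trans hxy.2
  obtain ⟨y, rfl⟩ : ∃ y' : ℕ × ℕ, intSquare y' = y :=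
    ⟨(y.1.toNat, y.2.toNat), Prod.ext (Int.toNat_of_nonneg h1) (Int.toNat_of_nonneg h2)⟩
  rw [intSquare_le] at hxy hyz
  exact Finset.mem_image_of_mem _ (α.mem_of_between hx' hz' hxy hyz)

theorem intCells_connected (α : PlacedConnectedSkewShape) :
    ∀ x ∈ α.intCells, ∀ y ∈ α.intCells, Relation.ReflTransGen (AdjIn α.intCells) x y := by
  intro x hx y hy
  obtain ⟨x, hx', rfl⟩ := Finset.mem_image.1 hx
  obtain ⟨y, hy', rfl⟩ := Finset.mem_image.1 hy
  refine Relation.ReflTransGen.lift intSquare (fun u v huv => ?_) _ _ (α.connected x hx' y hy')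
  exact ⟨Finset.mem_image_of_mem _ huv.1, Finset.mem_image_of_mem _ huv.2.1,
    shareEdgeInt_intSquare.2 huv.2.2⟩

theorem exists_word {n : ℕ} {α : PlacedConnectedSkewShape} (hα : α.DiagLE n) :
    ∃ a b w, IsWord n 1 w ∧ wordCells w a b 1 = α.intCells :=
  exists_word_of_connected n α.intCells (α.nonempty.image _) α.intCells_mem_of_between
    α.intCells_connected fun k => (α.diagLength_eq k).symm.trans_le (hα k)

theorem exists_intCells_eq {n : ℕ} {w : List (Bool × Bool)} (hw : IsWord n 1 w) :
    ∃ α : PlacedConnectedSkewShape, α.intCells = wordCells w (wordRow w) 0 1 := by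
  -- Starting in row `wordRow w` and column `0` makes the rows fill `1, …, wordRow w`, so every
  -- coordinate is a natural number.
  set S := wordCells w (wordRow w) 0 1 with hS
  set T : Finset (ℕ × ℕ) := S.image fun p => (p.1.toNat, p.2.toNat) with hT
  have hpos : ∀ p ∈ S, intSquare (p.1.toNat, p.2.toNat) = p := by
    intro p hp
    have h1 := hw.fst_mem hp
    have h2 := hw.snd_mem hp
    exact Prod.ext (Int.toNat_of_nonneg (by omega)) (Int.toNat_of_nonneg (by omega))
  have hTS : ∀ c, c ∈ T ↔ intSquare c ∈ S := by
    intro c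
    rw [hT, Finset.mem_image]
    constructor
    · rintro ⟨p, hp, rfl⟩
      rwa [hpos p hp]
    · exact fun hc => ⟨_, hc, rfl⟩
  refine ⟨⟨T, exists_youngDiagram_sdiff fun x hx z hz y hxy hyz => ?_,
    Finset.Nonempty.image ⟨_, hw.upper_left_mem _ _⟩ _, fun u hu v hv => ?_⟩, ?_⟩
  · rw [hTS] at *
    have h1 := hw.snd_mem hx
    have h2 := hw.fst_mem hz
    rw [← intSquare_le] at hxy hyz
    -- The initial diagonal is one square, in the bottom row and leftmost column, so the content
    -- bound is automatic.
    refine hw.mem_of_between hx hz hxy hyz ?_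
    have h3 := hxy.2
    have h4 := hyz.1
    omega
  · rw [hTS] at hu hv
    refine Relation.ReflTransGen.lift (p := fun a b => a ∈ T ∧ b ∈ T ∧ ShareEdge a b)
      (fun p : ℤ × ℤ => (p.1.toNat, p.2.toNat)) ?_ _ _ (hw.connected hu hv)
    rintro p r ⟨hp, hr, he⟩
    refine ⟨Finset.mem_image_of_mem _ hp, Finset.mem_image_of_mem _ hr, ?_⟩
    rwa [← shareEdgeInt_intSquare, hpos p hp, hpos r hr]
  · ext p
    rw [intCells, Finset.mem_image]
    constructor
    · rintro ⟨c, hc, rfl⟩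
      exact (hTS c).1 hc
    · exact fun hp => ⟨_, Finset.mem_image_of_mem _ hp, hpos p hp⟩

/-- The shape with a given word. -/
noncomputable def ofWord {n : ℕ} (w : {w // IsWord n 1 w}) : PlacedConnectedSkewShape :=
  (exists_intCells_eq w.2).choose

theorem intCells_ofWord {n : ℕ} (w : {w // IsWord n 1 w}) :
    (ofWord w).intCells = wordCells w.1 (wordRow w.1) 0 1 :=
  (exists_intCells_eq w.2).choose_spec

theorem diagLE_ofWord {n : ℕ} (w : {w // IsWord n 1 w}) : (ofWord w).DiagLE n := by
  intro k
  rw [diagLength_eq, intCells_ofWord]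
  exact w.2.card_filter_le _ _ k

theorem row_ofWord {n : ℕ} (w : {w // IsWord n 1 w}) : (ofWord w).row = wordRow w.1 := by
  rw [row_eq, intCells_ofWord, w.2.image_fst, Int.card_Ico]
  simp

theorem col_ofWord {n : ℕ} (w : {w // IsWord n 1 w}) : (ofWord w).col = wordCol w.1 := by
  rw [col_eq, intCells_ofWord, w.2.image_snd, Int.card_Ico]
  simp

theorem area_ofWord {n : ℕ} (w : {w // IsWord n 1 w}) : (ofWord w).area = wordArea 1 w.1 := by
  rw [area_eq, intCells_ofWord, card_wordCells]

end PlacedConnectedSkewShape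

open PlacedConnectedSkewShape

/-- The bounded connected skew shape with a given word, up to translation. -/
noncomputable def shapeOfWord (n : ℕ) (w : {w // IsWord n 1 w}) : BoundedSkewShape n :=
  ⟨Quotient.mk _ (ofWord w), diagLE_ofWord w⟩

theorem shapeOfWord_bijective (n : ℕ) : Function.Bijective (shapeOfWord n) := by
  constructor
  · intro w w' h
    have h1 : IsTranslate (ofWord w) (ofWord w') := Quotient.exact (congrArg Subtype.val h)
    obtain ⟨a, b, h2⟩ := isTranslate_iff.1 h1
    rw [intCells_ofWord, intCells_ofWord, wordCells_translate] at h2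
    exact Subtype.ext (wordCells_injective w'.2 w.2 h2).symm
  · rintro ⟨α, hα⟩
    induction α using Quotient.inductionOn with
    | h α =>
      obtain ⟨a, b, w, hw, h⟩ := PlacedConnectedSkewShape.exists_word (n := n) (α := α) hα
      refine ⟨⟨w, hw⟩, Subtype.ext (Quotient.sound (isTranslate_iff.2 ⟨a - wordRow w, b, ?_⟩))⟩
      rw [intCells_ofWord, wordCells_translate, ← h]
      congr 1 <;> ring

theorem shapeWeight_shapeOfWord {n : ℕ} (w : {w // IsWord n 1 w}) :
    shapeWeight (shapeOfWord n w).1 =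
      (qNu * zVar ^ 2) ^ wordCol w.1 * qNu ^ wordRow w.1 * qVar ^ wordArea 1 w.1 := by
  rw [← col_ofWord, ← row_ofWord, ← area_ofWord]
  rfl

/-! ### Generating functions of words -/

/-- The weight of a step of the two boundary paths. -/
noncomputable def stepWeight (s : Bool × Bool) : PSeries :=
  (if s.1 then qNu * zVar ^ 2 else 1) * (if s.2 then 1 else qNu)

/-- The weight of a word, which is zero if the list of steps is not a word. -/
noncomputable def wordWeight (n : ℕ) : ℕ → List (Bool × Bool) → PSeries
  | h, [] => if h = 1 ∧ 1 ≤ n then qVar ^ h * (qNu * zVar) ^ 2 else 0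
  | h, s :: w => if 1 ≤ h ∧ h ≤ n then
      qVar ^ h * stepWeight s * wordWeight n (nextLen h s) w else 0

theorem IsWord.wordWeight_eq {n h : ℕ} {w : List (Bool × Bool)} (hw : IsWord n h w) :
    wordWeight n h w = (qNu * zVar ^ 2) ^ wordCol w * qNu ^ wordRow w * qVar ^ wordArea h w := by
  induction w generalizing h with
  | nil =>
    rw [wordWeight, if_pos (show h = 1 ∧ 1 ≤ n from hw), wordCol, wordRow, wordArea]
    ring
  | cons s w ih =>
    rw [wordWeight, if_pos ⟨hw.1, hw.2.1⟩, ih hw.2.2, wordCol, wordRow, wordArea, stepWeight]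
    obtain ⟨s1, s2⟩ := s
    cases s1 <;> cases s2 <;> simp <;> ring

theorem wordWeight_eq_zero {n h : ℕ} {w : List (Bool × Bool)} (hw : ¬ IsWord n h w) :
    wordWeight n h w = 0 := by
  induction w generalizing h with
  | nil => exact if_neg hw
  | cons s w ih =>
    rw [wordWeight]
    split_ifs with h1
    · rw [ih fun h2 => hw ⟨h1.1, h1.2, h2⟩, mul_zero]
    · rfl

/-- Every diagonal has at least one square. Hence only finitely many words contribute to a given
coefficient, which gives summability. -/
theorem qVar_pow_length_dvd_wordWeight (n h : ℕ) (w : List (Bool × Bool)) :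
    qVar ^ w.length ∣ wordWeight n h w := by
  induction w generalizing h with
  | nil => simp
  | cons s w ih =>
    rw [wordWeight]
    split_ifs with h1
    · rw [List.length_cons, pow_succ']
      refine mul_dvd_mul (Dvd.dvd.mul_right ?_ _) (ih _)
      exact dvd_pow_self _ (by omega)
    · exact dvd_zero _

theorem summable_wordWeight (n h : ℕ) : Summable (wordWeight n h) := by
  rw [MvPowerSeries.WithPiTopology.summable_iff_summable_coeff]
  intro d
  refine summable_of_hasFiniteSupport ((List.finite_length_le (Bool × Bool) (d 1)).subset ?_)
  intro w hw
  by_contra hlt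
  exact hw (MvPowerSeries.X_pow_dvd_iff.1 (qVar_pow_length_dvd_wordWeight n h w) d
    (not_le.1 hlt))

/-- The sum of the weights of all words that start with a diagonal of length `h`. -/
noncomputable def wordSum (n h : ℕ) : PSeries := ∑' w, wordWeight n h w

theorem hasSum_shapeWeight (n : ℕ) :
    HasSum (fun α : BoundedSkewShape n => shapeWeight α.1) (wordSum n 1) := by
  rw [← (Equiv.ofBijective _ (shapeOfWord_bijective n)).hasSum_iff]
  have h : HasSum (wordWeight n 1 ∘ ((↑) : {w | IsWord n 1 w} → List (Bool × Bool)))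
      (wordSum n 1) := by
    refine (hasSum_subtype_iff_of_support_subset fun w hw => ?_).2
      (summable_wordWeight n 1).hasSum
    by_contra hn
    exact hw (wordWeight_eq_zero hn)
  have he : (fun α : BoundedSkewShape n => shapeWeight α.1) ∘
      Equiv.ofBijective _ (shapeOfWord_bijective n) =
      wordWeight n 1 ∘ ((↑) : {w | IsWord n 1 w} → List (Bool × Bool)) :=
    funext fun w => (shapeWeight_shapeOfWord w).trans w.2.wordWeight_eq.symm
  rw [he]
  exact h

theorem wordSum_eq_zero {n h : ℕ} (hh : ¬ (1 ≤ h ∧ h ≤ n)) : wordSum n h = 0 := by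
  rw [wordSum]
  convert tsum_zero with w
  exact wordWeight_eq_zero fun hw => hh ⟨hw.one_le, hw.le⟩

theorem hasSum_list {α M : Type*} [Fintype α] [AddCommMonoid M] [TopologicalSpace M]
    [ContinuousAdd M] {f : List α → M} {g : α → M} (hf : ∀ a, HasSum (fun l => f (a :: l)) (g a)) :
    HasSum f (f [] + ∑ a, g a) := by
  classical
  have h1 := (hasSum_ite_eq [] (f [])).add (hasSum_sum (s := Finset.univ) fun a _ =>
    (hasSum_extend_zero (List.cons_injective (a := a))).2 (hf a))
  convert h1 with l
  cases l with
  | nil =>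
    rw [if_pos rfl, Finset.sum_eq_zero, add_zero]
    intro a _
    exact Function.extend_apply' _ _ _ (by simp)
  | cons a l =>
    rw [if_neg (by simp), zero_add, Finset.sum_eq_single a]
    · exact (List.cons_injective.extend_apply (fun l => f (a :: l)) 0 l).symm
    · intro b _ hb
      exact Function.extend_apply' _ _ _ (by simp [hb])
    · simp

/-- Split off the first step; the four kinds of steps give the four sums, and the empty word the
inhomogeneous term. At `h = 1` the last term is `wordSum n 0`, which vanishes. -/
theorem wordSum_eq {n h : ℕ} (h1 : 1 ≤ h) (hn : h ≤ n) :
    wordSum n h = qVar ^ h * ((if h = 1 then (qNu * zVar) ^ 2 else 0) + qNu * wordSum n h +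
      qNu * zVar ^ 2 * wordSum n h + wordSum n (h + 1) +
      (qNu * zVar) ^ 2 * wordSum n (h - 1)) := by
  have hcons (s : Bool × Bool) (w : List (Bool × Bool)) : wordWeight n h (s :: w) =
      qVar ^ h * stepWeight s * wordWeight n (nextLen h s) w := by
    rw [wordWeight, if_pos ⟨h1, hn⟩]
  have hnil : wordWeight n h [] = qVar ^ h * (if h = 1 then (qNu * zVar) ^ 2 else 0) := by
    rw [wordWeight]
    by_cases hh : h = 1
    · rw [if_pos ⟨hh, h1.trans hn⟩, if_pos hh]
    · rw [if_neg fun h => hh h.1, if_neg hh, mul_zero]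
  have hs (s : Bool × Bool) : HasSum (fun w => wordWeight n h (s :: w))
      (qVar ^ h * stepWeight s * wordSum n (nextLen h s)) := by
    simp only [hcons]
    exact (summable_wordWeight n _).hasSum.mul_left _
  conv_lhs => rw [wordSum, (hasSum_list hs).tsum_eq]
  simp only [hnil, Fintype.sum_prod_type, Fintype.sum_bool, nextLen,
    stepWeight]
  simp only [if_true, Bool.false_eq_true, if_false]
  ring

/-! ### Solving the recurrence by Lommel polynomials -/

section Lommel

variable {K : Type*} [Field K]

/-- The coefficient depends only on `m + k`, so the sequences for `k = 1` and `k = 2`, shifted by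
one index, obey the same recurrence. -/
theorem qLommel_succ_succ (z p t : K) (k m : ℕ) :
    qLommel z p (t * p ^ k) (m + 2) = (z + z⁻¹ * (1 - t * p ^ (m + k + 1))) *
      qLommel z p (t * p ^ k) (m + 1) - qLommel z p (t * p ^ k) m := by
  rw [qLommel]
  ring

/-- The determinant of two solutions of one recurrence is constant, because the trailing coefficient
is `-1`. -/
theorem qLommel_casoratian (z p t : K) (m : ℕ) :
    qLommel z p (t * p ^ 1) (m + 2) * qLommel z p (t * p ^ 2) m -
      qLommel z p (t * p ^ 1) (m + 1) * qLommel z p (t * p ^ 2) (m + 1) = -1 := by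
  induction m with
  | zero =>
    simp only [qLommel]
    ring
  | succ m ih =>
    rw [← ih, qLommel_succ_succ z p t 1 (m + 1), qLommel_succ_succ z p t 2 m]
    ring

theorem eq_qLommel_of_recurrence {z q t : K} (hz : z ≠ 0) (hq : q ≠ 0) (ht : t ≠ 0) (m : ℕ)
    (x : ℕ → K) (h0 : x 0 = 0)
    (hx : ∀ h, 1 ≤ h → h ≤ m + 1 → x h = q ^ h * ((if h = 1 then (t * z) ^ 2 else 0) + t * x h +
      t * z ^ 2 * x h + x (h + 1) + (t * z) ^ 2 * x (h - 1))) (k : ℕ) (hk : k ≤ m) :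
    x (k + 2) = (-(t * z)) ^ (k + 1) * (qLommel z q⁻¹ (t⁻¹ * q⁻¹ ^ 1) (k + 1) * x 1 +
      t * z * qLommel z q⁻¹ (t⁻¹ * q⁻¹ ^ 2) k) := by
  have hrec : ∀ h, 1 ≤ h → h ≤ m + 1 → x (h + 1) =
      -(t * z) * (z + z⁻¹ * (1 - t⁻¹ * q⁻¹ ^ h)) * x h - (t * z) ^ 2 * x (h - 1) -
        (if h = 1 then (t * z) ^ 2 else 0) := by
    intro h h1 h2
    have h3 : q⁻¹ ^ h * x h = (if h = 1 then (t * z) ^ 2 else 0) + t * x h +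
        t * z ^ 2 * x h + x (h + 1) + (t * z) ^ 2 * x (h - 1) := by
      conv_lhs => rw [hx h h1 h2]
      rw [← mul_assoc, ← mul_pow, inv_mul_cancel₀ hq, one_pow, one_mul]
    -- This identity matches the recurrence, divided by `q ^ h`, with the Lommel coefficient in base
    -- `q⁻¹`.
    have h4 : -(t * z) * (z + z⁻¹ * (1 - t⁻¹ * q⁻¹ ^ h)) = q⁻¹ ^ h - t - t * z ^ 2 := by
      generalize q⁻¹ ^ h = r
      field_simp
      ring
    rw [h4]
    linear_combination -h3
  induction k using Nat.twoStepInduction with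
  | zero =>
    rw [hrec 1 le_rfl (by omega), h0]
    simp only [qLommel, if_true]
    ring
  | one =>
    have h1 := hrec 1 le_rfl (by omega)
    have h2 := hrec 2 (by omega) (by omega)
    simp only [h0, if_true, Nat.sub_self] at h1
    rw [h2, h1]
    simp [qLommel]
    ring
  | more k ih1 ih2 =>
    rw [hrec (k + 3) (by omega) (by omega), if_neg (by omega), ih2 (by omega),
      show k + 3 - 1 = k + 2 by omega, ih1 (by omega), qLommel_succ_succ z q⁻¹ t⁻¹ 1 (k + 1),
      qLommel_succ_succ z q⁻¹ t⁻¹ 2 k]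
    ring

/-- If the denominator vanished, the condition `x (m + 2) = 0` would make the numerator vanish too,
contradicting the Casoratian, or the value 1 of the numerator when `m = 0`. -/
theorem qLommel_ne_zero_and_eq_div {z q t : K} (hz : z ≠ 0) (hq : q ≠ 0) (ht : t ≠ 0) (m : ℕ)
    (x : ℕ → K) (h0 : x 0 = 0) (hm : x (m + 2) = 0)
    (hx : ∀ h, 1 ≤ h → h ≤ m + 1 → x h = q ^ h * ((if h = 1 then (t * z) ^ 2 else 0) + t * x h +
      t * z ^ 2 * x h + x (h + 1) + (t * z) ^ 2 * x (h - 1))) :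
    qLommel z q⁻¹ (t⁻¹ * q⁻¹ ^ 1) (m + 1) ≠ 0 ∧
      x 1 = -(t * z) *
        (qLommel z q⁻¹ (t⁻¹ * q⁻¹ ^ 2) m / qLommel z q⁻¹ (t⁻¹ * q⁻¹ ^ 1) (m + 1)) := by
  have htz : t * z ≠ 0 := mul_ne_zero ht hz
  have key := eq_qLommel_of_recurrence hz hq ht m x h0 hx m le_rfl
  rw [hm, eq_comm, mul_eq_zero, or_iff_right (pow_ne_zero _ (neg_ne_zero.2 htz))] at key
  have hne : qLommel z q⁻¹ (t⁻¹ * q⁻¹ ^ 1) (m + 1) ≠ 0 := by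
    intro h1
    rw [h1, zero_mul, zero_add, mul_eq_zero, or_iff_right htz] at key
    cases m with
    | zero => exact one_ne_zero key
    | succ m =>
      have := qLommel_casoratian z q⁻¹ t⁻¹ m
      rw [h1, key] at this
      simp at this
  refine ⟨hne, ?_⟩
  rw [mul_div_assoc', eq_div_iff hne]
  linear_combination key

end Lommel

theorem mainTheorem2 (m : ℕ) :
    Summable (fun α : BoundedSkewShape (m + 1) => shapeWeight α.1) ∧
    lommelR (m + 1) 1 ≠ 0 ∧
    algebraMap PSeries PField (∑' α : BoundedSkewShape (m + 1), shapeWeight α.1) =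
      -(algebraMap PSeries PField qNu * algebraMap PSeries PField zVar) *
        (lommelR m 2 / lommelR (m + 1) 1) := by
  have hX (i : Fin 3) : algebraMap PSeries PField (MvPowerSeries.X i) ≠ 0 := by
    rw [Ne, FaithfulSMul.algebraMap_eq_zero_iff]
    intro h
    have := congrArg (MvPowerSeries.coeff (Finsupp.single i 1)) h
    simp [MvPowerSeries.coeff_X] at this
  rw [(hasSum_shapeWeight (m + 1)).tsum_eq]
  refine ⟨(hasSum_shapeWeight (m + 1)).summable, ?_⟩
  refine qLommel_ne_zero_and_eq_div (hX 0) (hX 1) (hX 2) m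
    (fun h => algebraMap PSeries PField (wordSum (m + 1) h)) ?_ ?_ fun h h1 h2 => ?_
  · rw [wordSum_eq_zero (by omega), map_zero]
  · rw [wordSum_eq_zero (by omega), map_zero]
  · have := congrArg (algebraMap PSeries PField) (wordSum_eq h1 h2)
    simp only [map_mul, map_add, map_pow, apply_ite (algebraMap PSeries PField), map_zero] at this
    exact this
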